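/- Let $d\ge 1$ be an integer. For an infinite word $w=w_0w_1w_2\cdots\in\{1,\dots,d\}^{\mathbb N}$ and $n\ge 0$, let $p_w(n)$ be the number of distinct words of length $n$ that occur in $w$ as a block of $n$ consecutive letters. Say that $w$ has rationally independent letter frequencies if for every letter $a\in\{1,\dots,d\}$ the limit \[ f_a=\lim_{n\to\infty}\frac{|\{\,0\le i<n : w_i=a\,\}|}{n} \] exists, and the real numbers $f_1,\dots,f_d$ are linearly independent over $\mathbb Q$. \textbf{Theorem (Tijdeman).} Let $w\in\{1,\dots,d\}^{\mathbb N}$ be an infinite word with $p_w(1)=d$ and rationally independent letter frequencies. Then $p_w(n)\ge (d-1)n+1$ for every integer $n\ge 1$. Moreover, for every $d\ge 1$ there exists an infinite word $w\in\{1,\dots,d\}^{\mathbb N}$ with $p_w(1)=d$ and rationally independent letter frequencies such that $p_w(n)=(d-1)n+1$ for every integer $n\ge 1$. -/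

import Mathlib

/-- The finite word `u` of length `n` is a factor of the infinite word `w`:
it occurs in `w` as a block of `n` consecutive letters. -/
def IsFactor {α : Type*} {n : ℕ} (u : Fin n → α) (w : ℕ → α) : Prop :=
  ∃ i : ℕ, ∀ j : Fin n, u j = w (i + (j : ℕ))

/-- The complexity `p_w(n)`: the number of distinct factors of length `n` of the infinite
word `w`. The alphabet is finite, so the set that is counted is finite. -/
noncomputable def complexity {d : ℕ} (w : ℕ → Fin d) (n : ℕ) : ℕ :=
  Set.ncard {u : Fin n → Fin d | IsFactor u w}

/-- The number of occurrences of the letter `a` among the first `n` letters of `w`. -/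
def prefixCount {d : ℕ} (w : ℕ → Fin d) (n : ℕ) (a : Fin d) : ℕ :=
  ((Finset.range n).filter (fun i => w i = a)).card

/-- The letter frequencies of `w` exist and are the numbers `f a`: for each letter `a`, the
proportion of `a` in the prefix of length `n` tends to `f a` as `n` tends to infinity. -/
def HasLetterFrequencies {d : ℕ} (w : ℕ → Fin d) (f : Fin d → ℝ) : Prop :=
  ∀ a : Fin d,
    Filter.Tendsto (fun n : ℕ => (prefixCount w n a : ℝ) / (n : ℝ)) Filter.atTop (nhds (f a))

/-- The letter frequencies of `w` exist and are linearly independent over `ℚ`. -/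
def HasRationallyIndependentFrequencies {d : ℕ} (w : ℕ → Fin d) : Prop :=
  ∃ f : Fin d → ℝ, HasLetterFrequencies w f ∧ LinearIndependent ℚ f

/-!
Lower bound. Among the functions of a position in `w`, those that depend on the letter at that
position form a space of dimension `d`, and those that depend on the next `n` letters a space of
dimension `p_w(n)`. The forward differences of the latter form a space of dimension at least
`p_w(n) - 1`. Both the letter functions and these differences depend on the next `n + 1` letters
only. The two spaces meet trivially: a difference has bounded partial sums, whereas the averages of
a letter function `c ∘ w` tend to `∑ a, c a * f a`, which is nonzero for rational `c ≠ 0`. Hence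
`d + (p_w(n) - 1) ≤ p_w(n + 1)`.

Existence. Cut the circle `ℝ / ℤ` into `d` intervals, the first one being `[0, α)`, with rationally
independent lengths, and code an orbit of the rotation by `α`. The frequencies are the lengths, and
a factor of length `n` is determined by the position of its starting point relative to the preimages
of the `d` endpoints under the first `n` iterates. As the endpoints `0` and `α` lie on one orbit,
there are at most `(d - 1) * n + 1` such preimages.
-/

open Filter Finset Topology

section FactoringThrough

variable {ι β γ : Type*} (K : Type*)

/-- The space of `K`-valued functions `g` on `ι` such that `g i` depends only on `f i`. For
`f = window w n` these are the functions of a position in `w` that see only the next `n` letters. -/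
def factoringThrough [Semiring K] (f : ι → β) : Submodule K (ι → K) where
  carrier := {g | g.FactorsThrough f}
  add_mem' hg hh _ _ hij := congrArg₂ (· + ·) (hg hij) (hh hij)
  zero_mem' _ _ _ := rfl
  smul_mem' r _ hg _ _ hij := congrArg (r * ·) (hg hij)

variable {K}

theorem mem_factoringThrough [Semiring K] {f : ι → β} {g : ι → K} :
    g ∈ factoringThrough K f ↔ g.FactorsThrough f :=
  Iff.rfl

theorem factoringThrough_mono [Semiring K] {f : ι → β} {f' : ι → γ} (h : f.FactorsThrough f') :
    factoringThrough K f ≤ factoringThrough K f' :=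
  fun _ hg _ _ hij => hg (h hij)

theorem factoringThrough_eq_range_funLeft [Semiring K] (f : ι → β) :
    factoringThrough K f =
      LinearMap.range (LinearMap.funLeft K K (Set.rangeFactorization f)) := by
  ext g
  have hf : g.FactorsThrough f ↔ g.FactorsThrough (Set.rangeFactorization f) :=
    forall₂_congr fun i j => by simp only [Set.rangeFactorization, Subtype.mk.injEq]
  rw [mem_factoringThrough, hf, Function.factorsThrough_iff]
  exact exists_congr fun _ => eq_comm

instance finite_factoringThrough [Semiring K] (f : ι → β) [Finite (Set.range f)] :
    Module.Finite K (factoringThrough K f) :=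
  factoringThrough_eq_range_funLeft (K := K) f ▸ inferInstance

theorem finrank_factoringThrough [Semiring K] [StrongRankCondition K] (f : ι → β)
    [Finite (Set.range f)] :
    Module.finrank K (factoringThrough K f) = (Set.range f).ncard := by
  have := Fintype.ofFinite (Set.range f)
  rw [factoringThrough_eq_range_funLeft, LinearMap.finrank_range_of_inj
    (LinearMap.funLeft_injective_of_surjective K K _ Set.rangeFactorization_surjective),
    Module.finrank_fintype_fun_eq_card, ← Nat.card_eq_fintype_card, Nat.card_coe_set_eq]

end FactoringThrough

section ForwardDifference

variable (K : Type*)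

/-- The forward difference operator on sequences with values in `K`, as a `K`-linear map. -/
def forwardDifference [Ring K] : (ℕ → K) →ₗ[K] (ℕ → K) :=
  LinearMap.funLeft K K Nat.succ - LinearMap.id

variable {K}

theorem forwardDifference_apply [Ring K] (g : ℕ → K) (i : ℕ) :
    forwardDifference K g i = g (i + 1) - g i :=
  rfl

theorem sum_range_forwardDifference [Ring K] (g : ℕ → K) (n : ℕ) :
    ∑ i ∈ range n, forwardDifference K g i = g n - g 0 :=
  sum_range_sub g n

theorem finrank_le_finrank_map_forwardDifference_add_one [DivisionRing K] (V : Submodule K (ℕ → K))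
    [FiniteDimensional K V] :
    Module.finrank K V ≤ Module.finrank K (V.map (forwardDifference K)) + 1 := by
  let T : V →ₗ[K] V.map (forwardDifference K) × K :=
    ((forwardDifference K).submoduleMap V).prod ((LinearMap.proj 0).comp V.subtype)
  have hT : Function.Injective T := by
    rw [← LinearMap.ker_eq_bot, LinearMap.ker_eq_bot']
    rintro ⟨g, hg⟩ h
    have hdiff : forwardDifference K g = 0 := congrArg (fun p => (p.1 : ℕ → K)) h
    have hzero : g 0 = 0 := congrArg Prod.snd h
    ext n
    simpa [hdiff, hzero] using (sum_range_forwardDifference g n).symm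
  simpa using LinearMap.finrank_le_finrank_of_injective hT

end ForwardDifference

section Window

variable {α : Type*}

/-- The factor of length `n` of `w` that starts at position `i`. -/
def window (w : ℕ → α) (n i : ℕ) : Fin n → α :=
  fun j => w (i + j)

theorem setOf_isFactor (w : ℕ → α) (n : ℕ) :
    {u : Fin n → α | IsFactor u w} = Set.range (window w n) := by
  ext u
  simp only [IsFactor, window, Set.mem_ofPred_eq, Set.mem_range, funext_iff, eq_comm]

theorem window_succ_eq_cons (w : ℕ → α) (n i : ℕ) :
    window w (n + 1) i = Fin.cons (w i) (window w n (i + 1)) := by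
  funext j
  cases j using Fin.cases with
  | zero => rfl
  | succ j => exact congrArg w (by simp only [Fin.val_succ]; ring)

theorem window_succ_eq_snoc (w : ℕ → α) (n i : ℕ) :
    window w (n + 1) i = Fin.snoc (window w n i) (w (i + n)) := by
  funext j
  cases j using Fin.lastCases with
  | last => simp only [window, Fin.snoc_last, Fin.val_last]
  | cast j => simp only [window, Fin.snoc_castSucc, Fin.val_castSucc]

theorem factorsThrough_window_succ (w : ℕ → α) (n : ℕ) :
    w.FactorsThrough (window w (n + 1)) := fun i j h => by
  rw [window_succ_eq_cons, window_succ_eq_cons, Fin.cons_inj] at h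
  exact h.1

theorem map_forwardDifference_le {K : Type*} [Ring K] (w : ℕ → α) (n : ℕ) :
    (factoringThrough K (window w n)).map (forwardDifference K) ≤
      factoringThrough K (window w (n + 1)) := by
  rintro _ ⟨g, hg, rfl⟩ i j hij
  have hsucc : window w n (i + 1) = window w n (j + 1) := by
    rw [window_succ_eq_cons, window_succ_eq_cons, Fin.cons_inj] at hij
    exact hij.2
  have hinit : window w n i = window w n j := by
    rw [window_succ_eq_snoc, window_succ_eq_snoc, Fin.snoc_inj] at hij
    exact hij.1
  rw [forwardDifference_apply, forwardDifference_apply, hg hsucc, hg hinit]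

end Window

section LowerBound

variable {d : ℕ} {w : ℕ → Fin d} {f : Fin d → ℝ}

theorem complexity_eq_ncard_range_window (w : ℕ → Fin d) (n : ℕ) :
    complexity w n = (Set.range (window w n)).ncard :=
  congrArg Set.ncard (setOf_isFactor w n)

theorem complexity_zero (w : ℕ → Fin d) : complexity w 0 = 1 := by
  rw [complexity_eq_ncard_range_window,
    Set.range_eq_singleton_iff.2 fun i => Subsingleton.elim (window w 0 i) (window w 0 0),
    Set.ncard_singleton]

theorem sum_range_comp_eq_sum_prefixCount {M : Type*} [AddCommMonoid M] (w : ℕ → Fin d)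
    (c : Fin d → M) (n : ℕ) : ∑ i ∈ range n, c (w i) = ∑ a, prefixCount w n a • c a := by
  simp only [prefixCount, ← sum_const, sum_fiberwise']

theorem HasLetterFrequencies.tendsto_average (hf : HasLetterFrequencies w f) (c : Fin d → ℝ) :
    Tendsto (fun n : ℕ => (∑ i ∈ range n, c (w i)) / n) atTop (𝓝 (∑ a, c a * f a)) := by
  refine (tendsto_finsetSum _ fun a _ => (hf a).const_mul (c a)).congr fun n => ?_
  rw [sum_range_comp_eq_sum_prefixCount, sum_div]
  exact sum_congr rfl fun a _ => by rw [nsmul_eq_mul]; ring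

theorem HasLetterFrequencies.eq_zero_of_abs_sum_le (hf : HasLetterFrequencies w f)
    (hind : LinearIndependent ℚ f) {c : Fin d → ℚ} {B : ℚ}
    (hB : ∀ n, |∑ i ∈ range n, c (w i)| ≤ B) : c = 0 := by
  have hbound : ∀ n, |∑ i ∈ range n, (c (w i) : ℝ)| ≤ B := fun n => by exact_mod_cast hB n
  have hlim : Tendsto (fun n : ℕ => (∑ i ∈ range n, (c (w i) : ℝ)) / n) atTop (𝓝 0) :=
    tendsto_bdd_div_atTop_nhds_zero (.of_forall fun n => (abs_le.1 (hbound n)).1)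
      (.of_forall fun n => (abs_le.1 (hbound n)).2) tendsto_natCast_atTop_atTop
  have horth : ∑ a, (c a : ℝ) * f a = 0 :=
    tendsto_nhds_unique (hf.tendsto_average fun a => (c a : ℝ)) hlim
  refine funext (Fintype.linearIndependent_iff.1 hind c ?_)
  simpa only [Rat.smul_def] using horth

theorem HasLetterFrequencies.surjective (hf : HasLetterFrequencies w f)
    (hind : LinearIndependent ℚ f) : Function.Surjective w := by
  intro a
  by_contra! ha
  have hsingle : (Pi.single a 1 : Fin d → ℚ) = 0 :=
    hf.eq_zero_of_abs_sum_le hind (B := 0) fun n => by simp [ha]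
  simpa using congrFun hsingle a

theorem HasLetterFrequencies.disjoint_letters_differences (hf : HasLetterFrequencies w f)
    (hind : LinearIndependent ℚ f) (n : ℕ) :
    Disjoint (factoringThrough ℚ w)
      ((factoringThrough ℚ (window w n)).map (forwardDifference ℚ)) := by
  rw [Submodule.disjoint_def]
  rintro _ hletter ⟨g, hg, rfl⟩
  obtain ⟨c, hc⟩ := (Function.factorsThrough_iff _).1 hletter
  obtain ⟨φ, rfl⟩ := (Function.factorsThrough_iff _).1 hg
  obtain ⟨B, hB⟩ := (Set.finite_range fun u => |φ u - φ (window w n 0)|).bddAbove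
  have hzero : c = 0 := hf.eq_zero_of_abs_sum_le hind (B := B) fun N => by
    have hsum := sum_range_forwardDifference (φ ∘ window w n) N
    rw [hc] at hsum
    exact (congrArg abs hsum).trans_le (hB (Set.mem_range_self (window w n N)))
  rw [hc, hzero]
  rfl

theorem HasRationallyIndependentFrequencies.card_add_complexity_le
    (hw : HasRationallyIndependentFrequencies w) (n : ℕ) :
    d + complexity w n ≤ complexity w (n + 1) + 1 := by
  obtain ⟨f, hf, hind⟩ := hw
  let L := factoringThrough ℚ w
  let D := (factoringThrough ℚ (window w n)).map (forwardDifference ℚ)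
  have hL : Module.finrank ℚ L = d := by
    rw [finrank_factoringThrough, (hf.surjective hind).range_eq, Set.ncard_univ, Nat.card_fin]
  have hD : complexity w n ≤ Module.finrank ℚ D + 1 := by
    rw [complexity_eq_ncard_range_window, ← finrank_factoringThrough (K := ℚ)]
    exact finrank_le_finrank_map_forwardDifference_add_one _
  have hsup : Module.finrank ℚ ↥(L ⊔ D) = Module.finrank ℚ L + Module.finrank ℚ D := by
    rw [← Submodule.finrank_sup_add_finrank_inf_eq,
      (hf.disjoint_letters_differences hind n).eq_bot, finrank_bot, add_zero]
  have hle : Module.finrank ℚ ↥(L ⊔ D) ≤ complexity w (n + 1) := by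
    rw [complexity_eq_ncard_range_window, ← finrank_factoringThrough (K := ℚ)]
    exact Submodule.finrank_mono (sup_le
      (factoringThrough_mono (factorsThrough_window_succ w n)) (map_forwardDifference_le w n))
  omega

theorem HasRationallyIndependentFrequencies.le_complexity
    (hw : HasRationallyIndependentFrequencies w) (n : ℕ) : (d - 1) * n + 1 ≤ complexity w n := by
  induction n with
  | zero => rw [mul_zero, zero_add, complexity_zero]
  | succ n ih =>
    have hd : 0 < d := (w 0).pos
    have hstep := hw.card_add_complexity_le n
    rw [mul_add_one]
    omega

end LowerBound

section Equidistribution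

theorem norm_sum_range_shift_sub_le {E : Type*} [SeminormedAddCommGroup E] {g : ℕ → E} {C : ℝ}
    (hg : ∀ i, ‖g i‖ ≤ C) (k n : ℕ) :
    ‖∑ i ∈ range n, (g (i + k) - g i)‖ ≤ k * (2 * C) := by
  have hswap : ∑ i ∈ range n, (g (i + k) - g i) = ∑ i ∈ range k, (g (n + i) - g i) := by
    have h := sum_range_add g k n
    rw [add_comm k n, sum_range_add] at h
    rw [sum_sub_distrib, sum_sub_distrib, sub_eq_sub_iff_add_eq_add]
    simpa only [add_comm] using h.symm
  rw [hswap]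
  refine (norm_sum_le_of_le _ fun i _ => (norm_sub_le _ _).trans
    (add_le_add (hg (n + i)) (hg i))).trans_eq ?_
  rw [sum_const, card_range, nsmul_eq_mul, two_mul]

theorem fract_sub_eq_add_ite {R : Type*} [CommRing R] [LinearOrder R]
    [IsStrictOrderedRing R] [FloorRing R] (x t : R) :
    Int.fract (x - t) =
      Int.fract x - Int.fract t + if Int.fract x < Int.fract t then 1 else 0 := by
  have hx := Int.fract_nonneg x
  have hx' := Int.fract_lt_one x
  have ht := Int.fract_nonneg t
  have ht' := Int.fract_lt_one t
  have hfloor : x - t - (Int.fract x - Int.fract t) = ((⌊x⌋ - ⌊t⌋ : ℤ) : R) := by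
    rw [Int.fract, Int.fract]; push_cast; abel
  split_ifs with h
  · refine Int.fract_eq_iff.2 ⟨by linarith, by linarith, ⌊x⌋ - ⌊t⌋ - 1, ?_⟩
    rw [Int.cast_sub _ 1, ← hfloor, Int.cast_one]
    abel
  · exact Int.fract_eq_iff.2 ⟨by linarith, by linarith, ⌊x⌋ - ⌊t⌋, by rw [add_zero, hfloor]⟩

/-- The number of `i < n` for which the `i`-th point of the orbit of `x` under the rotation of
`ℝ / ℤ` by `α` lies in `[0, t)`. Points of the circle are represented in `[0, 1)`. -/
noncomputable def visitCount (α x t : ℝ) (n : ℕ) : ℕ :=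
  #{i ∈ range n | Int.fract (x + (i : ℕ) * α) < t}

theorem visitCount_mono (α x : ℝ) (n : ℕ) : Monotone fun t => visitCount α x t n :=
  fun _ _ h => card_le_card (monotone_filter_right _ fun _ _ hi => hi.trans_le h)

theorem visitCount_le (α x t : ℝ) (n : ℕ) : visitCount α x t n ≤ n :=
  (card_filter_le _ _).trans_eq (card_range n)

-- `[0, fract (k * α))` is a bounded remainder set: up to a constant, its indicator function is
-- the difference of `fract` and of a translate of `fract` along the orbit.
theorem visitCount_fract_eq (α x : ℝ) (k : ℤ) (n : ℕ) :
    (visitCount α x (Int.fract (k * α)) n : ℝ) = n * Int.fract (k * α) +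
      ∑ i ∈ range n, (Int.fract (x - k * α + i * α) - Int.fract (x + i * α)) := by
  have hite : ∀ i : ℕ, (if Int.fract (x + i * α) < Int.fract (k * α) then (1 : ℝ) else 0) =
      Int.fract (k * α) + (Int.fract (x - k * α + i * α) - Int.fract (x + i * α)) := fun i => by
    rw [sub_add_eq_add_sub, fract_sub_eq_add_ite]
    ring
  rw [visitCount, card_filter, Nat.cast_sum]
  simp only [Nat.cast_ite, Nat.cast_one, Nat.cast_zero, hite, sum_add_distrib, sum_const,
    card_range, nsmul_eq_mul]

theorem exists_abs_sum_fract_translate_sub_le (α x : ℝ) (k : ℤ) :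
    ∃ B, ∀ n : ℕ,
      |∑ i ∈ range n, (Int.fract (x - k * α + i * α) - Int.fract (x + i * α))| ≤ B := by
  have hshift (y : ℝ) (m n : ℕ) :
      |∑ i ∈ range n, (Int.fract (y + m * α + i * α) - Int.fract (y + i * α))| ≤ m * (2 * 1) := by
    have hle := norm_sum_range_shift_sub_le (g := fun i : ℕ => Int.fract (y + i * α)) (C := 1)
      (fun i => by rw [Real.norm_eq_abs, Int.abs_fract]; exact (Int.fract_lt_one _).le) m n
    have hterm (i : ℕ) : y + m * α + i * α = y + ((i + m : ℕ) : ℝ) * α := by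
      push_cast
      ring
    simpa only [hterm, Real.norm_eq_abs] using hle
  obtain ⟨m, rfl | rfl⟩ := k.eq_nat_or_neg
  · refine ⟨m * (2 * 1), fun n => ?_⟩
    rw [← abs_neg, ← sum_neg_distrib]
    simpa using hshift (x - m * α) m n
  · exact ⟨_, fun n => by simpa using hshift x m n⟩

theorem tendsto_visitCount_fract (α x : ℝ) (k : ℤ) :
    Tendsto (fun n : ℕ => (visitCount α x (Int.fract (k * α)) n : ℝ) / n) atTop
      (𝓝 (Int.fract (k * α))) := by
  obtain ⟨B, hB⟩ := exists_abs_sum_fract_translate_sub_le α x k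
  have hlim := (tendsto_bdd_div_atTop_nhds_zero (.of_forall fun n => (abs_le.1 (hB n)).1)
    (.of_forall fun n => (abs_le.1 (hB n)).2) tendsto_natCast_atTop_atTop).const_add
    (Int.fract (k * α))
  rw [add_zero] at hlim
  refine hlim.congr' ?_
  filter_upwards [eventually_ne_atTop 0] with n hn
  rw [visitCount_fract_eq, add_div, mul_div_cancel_left₀ _ (Nat.cast_ne_zero.2 hn)]

theorem exists_fract_mul_mem_Ioo {α : ℝ} (hα : Irrational α) {a b : ℝ} (ha : 0 ≤ a) (hab : a < b)
    (hb : b ≤ 1) : ∃ k : ℤ, Int.fract (k * α) ∈ Set.Ioo a b := by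
  have hdense : Dense (AddSubgroup.closure {α, 1} : Set ℝ) :=
    dense_addSubgroupClosure_pair_iff.2 (by rwa [div_one])
  obtain ⟨y, hy, hay, hyb⟩ := hdense.exists_between hab
  obtain ⟨k, m, rfl⟩ := AddSubgroup.mem_closure_pair.1 hy
  have hfract : Int.fract (k * α) = k • α + m • (1 : ℝ) :=
    Int.fract_eq_iff.2 ⟨by linarith, by linarith, -m, by simp⟩
  exact ⟨k, by rwa [hfract], by rwa [hfract]⟩

theorem tendsto_visitCount {α : ℝ} (hα : Irrational α) (x : ℝ) {t : ℝ} (ht : t ∈ Set.Icc 0 1) :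
    Tendsto (fun n : ℕ => (visitCount α x t n : ℝ) / n) atTop (𝓝 t) := by
  have hmono {s s' : ℝ} (h : s ≤ s') (n : ℕ) :
      (visitCount α x s n : ℝ) / n ≤ visitCount α x s' n / n := by
    gcongr
    exact visitCount_mono α x n h
  refine tendsto_order.2 ⟨fun a ha => ?_, fun b hb => ?_⟩
  · rcases lt_or_ge a 0 with ha0 | ha0
    · exact .of_forall fun n => ha0.trans_le (by positivity)
    · obtain ⟨k, hak, hkt⟩ := exists_fract_mul_mem_Ioo hα ha0 ha ht.2
      filter_upwards [(tendsto_visitCount_fract α x k).eventually_const_lt hak] with n hn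
      exact hn.trans_le (hmono hkt.le n)
  · rcases lt_or_ge 1 b with hb1 | hb1
    · exact .of_forall fun n => (div_le_one_of_le₀
        (by exact_mod_cast visitCount_le α x t n) n.cast_nonneg).trans_lt hb1
    · obtain ⟨k, htk, hkb⟩ := exists_fract_mul_mem_Ioo hα ht.1 hb hb1
      filter_upwards [(tendsto_visitCount_fract α x k).eventually_lt_const hkb] with n hn
      exact (hmono htk.le n).trans_lt hn

end Equidistribution

section IntervalIndex

variable {R : Type*} [LinearOrder R] {S : ℕ → R} {m : ℕ} {x y : R}

/-- The index `a ≤ m` of the interval `[S a, S (a + 1))` that contains `x`, for an increasing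
sequence `S` with `S 0 ≤ x < S (m + 1)`. -/
def intervalIndex (S : ℕ → R) (m : ℕ) (x : R) : Fin (m + 1) :=
  ⟨Nat.findGreatest (S · ≤ x) m, Nat.lt_succ_of_le (Nat.findGreatest_le m)⟩

theorem intervalIndex_eq_iff (hS : Monotone S) (hx : x ∈ Set.Ico (S 0) (S (m + 1)))
    (a : Fin (m + 1)) : intervalIndex S m x = a ↔ x ∈ Set.Ico (S a) (S (a + 1)) := by
  rw [Fin.ext_iff, intervalIndex, Nat.findGreatest_eq_iff]
  constructor
  · rintro ⟨-, hle, hlt⟩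
    refine ⟨?_, ?_⟩
    · rcases eq_or_ne (a : ℕ) 0 with ha | ha
      · simpa only [ha] using hx.1
      · exact hle ha
    · rcases (Nat.le_of_lt_succ a.2).eq_or_lt with ha | ha
      · simpa only [ha] using hx.2
      · exact not_le.1 (hlt (Nat.lt_succ_self a) ha)
  · rintro ⟨hle, hlt⟩
    exact ⟨Nat.le_of_lt_succ a.2, fun _ => hle, fun k hk _ => not_le.2 (hlt.trans_le (hS hk))⟩

theorem intervalIndex_congr (h : ∀ k ≤ m, x < S k ↔ y < S k) :
    intervalIndex S m x = intervalIndex S m y := by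
  refine Fin.ext (Nat.findGreatest_eq_iff.2
    ⟨Nat.findGreatest_le m, fun h0 => not_lt.1 fun hlt => ?_, fun k hk hkm => ?_⟩)
  · exact ((h _ (Nat.findGreatest_le m)).1 hlt).not_ge (Nat.findGreatest_of_ne_zero rfl h0)
  · rw [not_le, h k hkm, ← not_le]
    exact Nat.findGreatest_is_greatest hk hkm

theorem exists_mem_le_forall_lt_iff_lt {C : Finset R} (h : ∃ c ∈ C, c ≤ x) :
    ∃ p ∈ C, p ≤ x ∧ ∀ c ∈ C, p < c ↔ x < c := by
  obtain ⟨p, hp, hmax⟩ := exists_max_image {c ∈ C | c ≤ x} id (by simpa [Finset.Nonempty] using h)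
  simp only [mem_filter, id_eq] at hp hmax
  exact ⟨p, hp.1, hp.2, fun c hc =>
    ⟨fun hpc => not_le.1 fun hcx => hpc.not_ge (hmax c ⟨hc, hcx⟩), hp.2.trans_lt⟩⟩

end IntervalIndex

section RotationWord

variable {S : ℕ → ℝ} {m : ℕ} {α : ℝ}

/-- A sequence cutting `[0, 1)` into the `m + 1` intervals `[S a, S (a + 1))`, `a ≤ m`. Its values
beyond `m + 1` carry no meaning. -/
structure IsUnitPartition (S : ℕ → ℝ) (m : ℕ) : Prop where
  strictMono : StrictMono S
  zero : S 0 = 0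
  one : S (m + 1) = 1

theorem IsUnitPartition.mem_Ico (hS : IsUnitPartition S m) {k : ℕ} (hk : k ≤ m) :
    S k ∈ Set.Ico 0 1 :=
  ⟨hS.zero ▸ hS.strictMono.monotone k.zero_le, hS.one ▸ hS.strictMono (Nat.lt_succ_of_le hk)⟩

theorem IsUnitPartition.intervalIndex_fract_eq_iff (hS : IsUnitPartition S m) (x : ℝ)
    (a : Fin (m + 1)) :
    intervalIndex S m (Int.fract x) = a ↔ Int.fract x ∈ Set.Ico (S a) (S (a + 1)) := by
  refine intervalIndex_eq_iff hS.strictMono.monotone ?_ a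
  rw [hS.zero, hS.one]
  exact ⟨Int.fract_nonneg x, Int.fract_lt_one x⟩

/-- The word that codes the orbit of `x` under the rotation of `ℝ / ℤ` by `α` with respect to the
intervals `[S a, S (a + 1))`, `a ≤ m`. -/
noncomputable def rotationWord (S : ℕ → ℝ) (m : ℕ) (α x : ℝ) (i : ℕ) : Fin (m + 1) :=
  intervalIndex S m (Int.fract (x + i * α))

theorem window_rotationWord (S : ℕ → ℝ) (m : ℕ) (α x : ℝ) (n i : ℕ) :
    window (rotationWord S m α x) n i =
      window (rotationWord S m α (Int.fract (x + i * α))) n 0 := by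
  funext j
  refine congrArg (intervalIndex S m) (Int.fract_eq_fract.2 ⟨⌊x + i * α⌋, ?_⟩)
  rw [Int.fract]
  push_cast
  ring

theorem IsUnitPartition.prefixCount_rotationWord (hS : IsUnitPartition S m) (α x : ℝ) (n : ℕ)
    (a : Fin (m + 1)) :
    prefixCount (rotationWord S m α x) n a + visitCount α x (S a) n =
      visitCount α x (S (a + 1)) n := by
  simp only [prefixCount, visitCount, rotationWord, hS.intervalIndex_fract_eq_iff, Set.mem_Ico,
    card_filter]
  rw [← sum_add_distrib]
  refine sum_congr rfl fun i _ => ?_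
  have hlt : S a < S (a + 1) := hS.strictMono (Nat.lt_succ_self a)
  by_cases h : Int.fract (x + i * α) < S a
  · simp [h, h.trans hlt]
  · simp [h, not_lt.1 h]

theorem IsUnitPartition.hasLetterFrequencies_rotationWord (hS : IsUnitPartition S m)
    (hα : Irrational α) (x : ℝ) :
    HasLetterFrequencies (rotationWord S m α x) fun a => S (a + 1) - S a := by
  intro a
  have hmem {k : ℕ} (hk : k ≤ m + 1) : S k ∈ Set.Icc 0 1 :=
    ⟨hS.zero ▸ hS.strictMono.monotone k.zero_le, hS.one ▸ hS.strictMono.monotone hk⟩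
  refine ((tendsto_visitCount hα x (hmem a.2)).sub
    (tendsto_visitCount hα x (hmem a.2.le))).congr fun n => ?_
  rw [← hS.prefixCount_rotationWord α x n a, ← sub_div, Nat.cast_add, add_sub_cancel_right]

/-- The points of `[0, 1)` that one of the first `n` iterates of the rotation by `α` sends to an
endpoint `S k` with `k ≤ m`. -/
noncomputable def cutPoints (S : ℕ → ℝ) (m : ℕ) (α : ℝ) (n : ℕ) : Finset ℝ :=
  (range (m + 1) ×ˢ range n).image fun q => Int.fract (S q.1 - q.2 * α)

theorem fract_sub_mul_mem_cutPoints {k j n : ℕ} (hk : k ≤ m) (hj : j < n) :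
    Int.fract (S k - j * α) ∈ cutPoints S m α n :=
  mem_image.2 ⟨(k, j), mem_product.2 ⟨mem_range.2 (Nat.lt_succ_of_le hk), mem_range.2 hj⟩, rfl⟩

-- Apply `fract_sub_eq_add_ite` to `x + b - s = x - (s - b)` written in both ways and to
-- `x + b = x - (-b)`: membership of `x + b` in `[0, s)` only depends on the cut points of `x`.
theorem ite_fract_add_lt {x s : ℝ} (hx : x ∈ Set.Ico 0 1) (hs : s ∈ Set.Ico 0 1) (b : ℝ) :
    (if Int.fract (x + b) < s then (1 : ℝ) else 0) =
      (if x < Int.fract (s - b) then 1 else 0) - (if x < Int.fract (-b) then 1 else 0) +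
        (Int.fract (-b) - Int.fract (s - b) + s) := by
  have h₁ := fract_sub_eq_add_ite (x + b) s
  have h₂ := fract_sub_eq_add_ite x (s - b)
  have h₃ := fract_sub_eq_add_ite x (-b)
  rw [Int.fract_eq_self.2 hs] at h₁
  rw [Int.fract_eq_self.2 hx, sub_sub_eq_add_sub] at h₂
  rw [Int.fract_eq_self.2 hx, sub_neg_eq_add] at h₃
  linarith

theorem IsUnitPartition.window_rotationWord_congr (hS : IsUnitPartition S m) {p x : ℝ} {n : ℕ}
    (hp : p ∈ Set.Ico 0 1) (hx : x ∈ Set.Ico 0 1)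
    (h : ∀ c ∈ cutPoints S m α n, p < c ↔ x < c) :
    window (rotationWord S m α p) n 0 = window (rotationWord S m α x) n 0 := by
  funext j
  refine intervalIndex_congr fun k hk => ?_
  have hcut := h _ (fract_sub_mul_mem_cutPoints hk j.2)
  have hcut₀ := h _ (fract_sub_mul_mem_cutPoints m.zero_le j.2)
  rw [hS.zero, zero_sub] at hcut₀
  have hite : (if Int.fract (p + j * α) < S k then (1 : ℝ) else 0) =
      if Int.fract (x + j * α) < S k then 1 else 0 := by
    rw [ite_fract_add_lt hp (hS.mem_Ico hk), ite_fract_add_lt hx (hS.mem_Ico hk)]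
    simp only [hcut, hcut₀]
  rw [zero_add]
  grind

theorem IsUnitPartition.complexity_rotationWord_le_card_cutPoints (hS : IsUnitPartition S m)
    (α x : ℝ) {n : ℕ} (hn : 0 < n) :
    complexity (rotationWord S m α x) n ≤ #(cutPoints S m α n) := by
  have hzero : (0 : ℝ) ∈ cutPoints S m α n := by
    simpa [hS.zero] using fract_sub_mul_mem_cutPoints (S := S) (α := α) m.zero_le hn
  have hsub : Set.range (window (rotationWord S m α x) n) ⊆
      (fun p => window (rotationWord S m α p) n 0) '' cutPoints S m α n := by
    rintro _ ⟨i, rfl⟩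
    have hy : Int.fract (x + i * α) ∈ Set.Ico 0 1 := ⟨Int.fract_nonneg _, Int.fract_lt_one _⟩
    obtain ⟨p, hp, hpy, hsep⟩ := exists_mem_le_forall_lt_iff_lt ⟨0, hzero, hy.1⟩
    have hp0 : 0 ≤ p := by
      obtain ⟨q, -, rfl⟩ := mem_image.1 hp
      exact Int.fract_nonneg _
    refine ⟨p, hp, ?_⟩
    rw [window_rotationWord S m α x]
    exact hS.window_rotationWord_congr ⟨hp0, hpy.trans_lt hy.2⟩ hy hsep
  calc complexity (rotationWord S m α x) n
      = (Set.range (window (rotationWord S m α x) n)).ncard :=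
        complexity_eq_ncard_range_window _ n
    _ ≤ ((fun p => window (rotationWord S m α p) n 0) '' cutPoints S m α n).ncard :=
        Set.ncard_le_ncard hsub
    _ ≤ (cutPoints S m α n : Set ℝ).ncard := Set.ncard_image_le
    _ = #(cutPoints S m α n) := Set.ncard_coe_finset _

-- The rotation by `S 1` sends the endpoint `0` to the endpoint `S 1`, so the preimages of `S 1`
-- are, up to one, preimages of `0`.
theorem card_cutPoints_le (h0 : S 0 = 0) (hm : 0 < m) (n : ℕ) :
    #(cutPoints S m (S 1) n) ≤ m * n + 1 := by
  let P := (range (m + 1)).erase 1 ×ˢ range n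
  let cut (q : ℕ × ℕ) : ℝ := Int.fract (S q.1 - q.2 * S 1)
  have hsub : cutPoints S m (S 1) n ⊆ insert (Int.fract (S 1)) (P.image cut) := by
    intro y hy
    obtain ⟨⟨k, j⟩, hkj, rfl⟩ := mem_image.1 hy
    rw [mem_product, mem_range, mem_range] at hkj
    obtain rfl | hk := eq_or_ne k 1
    · cases j with
      | zero => simp
      | succ j =>
        refine mem_insert_of_mem (mem_image.2 ⟨(0, j), by simp [P]; omega, ?_⟩)
        simp only [cut, h0, Nat.cast_succ]
        congr 1
        ring
    · exact mem_insert_of_mem (mem_image.2 ⟨(k, j), by simp [P, hk, hkj], rfl⟩)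
  calc #(cutPoints S m (S 1) n) ≤ #(insert (Int.fract (S 1)) (P.image cut)) := card_le_card hsub
    _ ≤ #(P.image cut) + 1 := card_insert_le _ _
    _ ≤ #P + 1 := Nat.succ_le_succ card_image_le
    _ = m * n + 1 := by
      rw [card_product, card_erase_of_mem (by simpa using hm), card_range, card_range,
        Nat.add_sub_cancel]

end RotationWord

section Existence

theorem exists_pos_linearIndependent_rat : ∃ x : ℕ → ℝ, (∀ i, 0 < x i) ∧ LinearIndependent ℚ x := by
  have hpos : 0 < liouvilleNumber (2 : ℕ) :=
    (LiouvilleNumber.summable (by norm_num)).tsum_pos (fun _ => by positivity) 0 (by positivity)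
  refine ⟨fun i => liouvilleNumber (2 : ℕ) ^ i, fun i => pow_pos hpos i, ?_⟩
  have htrans : Transcendental ℤ (liouvilleNumber (2 : ℕ)) :=
    transcendental_liouvilleNumber le_rfl
  rw [← LinearIndependent.iff_fractionRing (R := ℤ)]
  have := (Polynomial.basisMonomials ℤ).linearIndependent.map'
    (Polynomial.aeval (liouvilleNumber (2 : ℕ))).toLinearMap
    (LinearMap.ker_eq_bot.2 (transcendental_iff_injective.1 htrans))
  simpa [Function.comp_def, Polynomial.aeval_monomial] using this

theorem exists_isUnitPartition_linearIndependent (m : ℕ) :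
    ∃ S : ℕ → ℝ, IsUnitPartition S m ∧
      LinearIndependent ℚ fun a : Fin (m + 1) => S (a + 1) - S a := by
  obtain ⟨x, hpos, hx⟩ := exists_pos_linearIndependent_rat
  set T := ∑ i ∈ range (m + 1), x i
  have hT0 : 0 < T := sum_pos (fun i _ => hpos i) nonempty_range_add_one
  have hdiff (k : ℕ) : (∑ i ∈ range (k + 1), x i) / T - (∑ i ∈ range k, x i) / T = T⁻¹ * x k := by
    rw [sum_range_succ]
    ring
  refine ⟨fun k => (∑ i ∈ range k, x i) / T, ⟨?_, by simp, div_self hT0.ne'⟩, ?_⟩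
  · refine strictMono_nat_of_lt_succ fun k => sub_pos.1 ?_
    rw [hdiff]
    exact mul_pos (inv_pos.2 hT0) (hpos k)
  · simp only [hdiff]
    exact (hx.comp _ Fin.val_injective).map' (LinearMap.mulLeft ℚ T⁻¹)
      (LinearMap.ker_eq_bot.2 (mul_right_injective₀ (inv_ne_zero hT0.ne')))

theorem irrational_of_linearIndependent_of_sum_eq_one {ι : Type*} [Fintype ι] [Nontrivial ι]
    {f : ι → ℝ} (hf : LinearIndependent ℚ f) (hsum : ∑ a, f a = 1) (a : ι) :
    Irrational (f a) := by
  classical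
  rintro ⟨q, hq⟩
  obtain ⟨b, hb⟩ := exists_ne a
  have hrel := Fintype.linearIndependent_iff.1 hf (fun c => (Pi.single a 1 : ι → ℚ) c - q) (by
    simp only [sub_smul, sum_sub_distrib, ← smul_sum, hsum, Pi.single_apply, ite_smul, one_smul,
      zero_smul, sum_ite_eq', mem_univ, if_true]
    rw [Rat.smul_def, hq, mul_one, sub_self])
  have hqa : 1 - q = 0 := by simpa using hrel a
  have hqb : 0 - q = 0 := by simpa [hb] using hrel b
  linarith

theorem IsUnitPartition.irrational_one {S : ℕ → ℝ} {m : ℕ} (hS : IsUnitPartition S m)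
    (hind : LinearIndependent ℚ fun a : Fin (m + 1) => S (a + 1) - S a) (hm : 0 < m) :
    Irrational (S 1) := by
  have : Nontrivial (Fin (m + 1)) := Fin.nontrivial_iff_two_le.2 (by omega)
  have hsum : ∑ a : Fin (m + 1), (S (a + 1) - S a) = 1 := by
    rw [Fin.sum_univ_eq_sum_range fun i => S (i + 1) - S i, sum_range_sub, hS.zero, hS.one,
      sub_zero]
  simpa [hS.zero] using irrational_of_linearIndependent_of_sum_eq_one hind hsum 0

theorem exists_hasRationallyIndependentFrequencies_complexity_le (m : ℕ) :
    ∃ w : ℕ → Fin (m + 1), HasRationallyIndependentFrequencies w ∧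
      ∀ n, 0 < n → complexity w n ≤ m * n + 1 := by
  obtain ⟨S, hS, hind⟩ := exists_isUnitPartition_linearIndependent m
  have hfreq {α : ℝ} (hα : Irrational α) :
      HasRationallyIndependentFrequencies (rotationWord S m α 0) :=
    ⟨_, hS.hasLetterFrequencies_rotationWord hα 0, hind⟩
  rcases m.eq_zero_or_pos with rfl | hm
  · refine ⟨_, hfreq irrational_sqrt_two, fun n _ => ?_⟩
    have : Subsingleton (Fin (0 + 1)) := Fin.subsingleton_one
    exact (Set.ncard_le_one_of_subsingleton _).trans (Nat.le_add_left 1 _)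
  · exact ⟨_, hfreq (hS.irrational_one hind hm), fun n hn =>
      (hS.complexity_rotationWord_le_card_cutPoints _ 0 hn).trans (card_cutPoints_le hS.zero hm n)⟩

end Existence

theorem mainTheorem4 (d : ℕ) (hd : 1 ≤ d) :
    (∀ w : ℕ → Fin d, complexity w 1 = d → HasRationallyIndependentFrequencies w →
      ∀ n : ℕ, 1 ≤ n → (d - 1) * n + 1 ≤ complexity w n) ∧
    (∃ w : ℕ → Fin d, complexity w 1 = d ∧ HasRationallyIndependentFrequencies w ∧
      ∀ n : ℕ, 1 ≤ n → complexity w n = (d - 1) * n + 1) := by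
  obtain ⟨m, rfl⟩ := Nat.exists_eq_add_of_le' hd
  refine ⟨fun w _ hw n _ => hw.le_complexity n, ?_⟩
  obtain ⟨w, hw, hle⟩ := exists_hasRationallyIndependentFrequencies_complexity_le m
  have heq (n : ℕ) (hn : 1 ≤ n) : complexity w n = (m + 1 - 1) * n + 1 :=
    le_antisymm (hle n hn) (hw.le_complexity n)
  exact ⟨w, by simpa using heq 1 le_rfl, hw, heq⟩
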